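/- **Setting.** Let $n\ge 0$, let $\Omega\subseteq\mathbb R^n$ be open with the Euclidean distance $d$, and let $\mathcal P\subseteq\Omega$ be a (finite or infinite) set of points, called sites. - The Voronoi cell of $p\in\mathcal P$ in $\Omega$ is $V_\Omega(p)=\{x\in\Omega : d(x,p)\le d(x,q)\text{ for all } q\in\mathcal P\}$. The Delaunay complex $\mathrm{Del}_\Omega(\mathcal P)$ is the nerve of the Voronoi cells: the set of nonempty finite $\sigma\subseteq\mathcal P$ with $\bigcap_{p\in\sigma}V_\Omega(p)\neq\emptyset$. - $\mathcal P$ is an $(\varepsilon,\mu)$-net of $\Omega$ if every $x\in\Omega$ is at distance $<\varepsilon$ from some site, and $d(p,q)\ge\mu$ for all distinct $p,q\in\mathcal P$. - A Delaunay ball of $\sigma\in\mathrm{Del}_\Omega(\mathcal P)$ is a ball $B(c,r)$ with $c\in\Omega$, $d(c,p)=r$ for all $p\in\sigma$ and $d(c,q)\ge r$ for all $q\in\mathcal P$. $\mathcal P$ is $\delta$-power protected if every $\sigma\in\mathrm{Del}_\Omega(\mathcal P)$ (of any dimension) has a Delaunay ball $B(c,r)$ such that the closed ball $B(c,\sqrt{r^2+\delta^2})$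 contains no point of $\mathcal P\setminus\sigma$. - A canvas $\mathcal C$ of $\Omega$ is a triangulation of $\Omega$: a geometric simplicial complex in $\mathbb R^n$ (possibly infinite), locally finite at every point of $\Omega$, whose underlying space $|\mathcal C|$ satisfies $\Omega\subseteq|\mathcal C|\subseteq\overline\Omega$. Write $e_{\mathcal C}$ for the supremum of its edge lengths. Each canvas vertex is coloured with a closest site (an arbitrary one in case of a tie). - The discrete cell $V^{\mathrm d}(p)$ is the union of all closed canvas simplices that have at least one vertex of colour $p$. The discrete Delaunay complex $\mathrm{Del}^{\mathrm d}(\mathcal P)$ is the nerve of the discrete cells: the set of nonempty finite $\sigma\subseteq\mathcal P$ with $\bigcap_{p\in\sigma}V^{\mathrm d}(p)\ne\emptyset$. **Theorem.** Let $\mathcal P$ be a $\delta$-power protected $(\varepsilon,\mu)$-net of $\Omega$. Assume that the Voronoi cells $V_\Omega(p)$, $p\in\mathcal P$, are convex, and that the boundary of $\Omega$ plays no role for the Delaunay complex, in the sense that $\mathrm{Del}_\Omega(\mathcal P)=\mathrm{Del}_{\mathbb R^n}(\mathcal P)$. (Both assumptions hold trivially when $\Omega=\mathbb R^n$; the first holds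 whenever $\Omega$ is convex.) Let $\mathcal C$ be a canvas of $\Omega$. If $$e_{\mathcal C}<\min\left\{\frac{\mu}{16},\ \frac{\delta^2}{64\,\varepsilon}\right\},$$ then $\mathrm{Del}^{\mathrm d}(\mathcal P)=\mathrm{Del}_\Omega(\mathcal P)$, for every choice of the closest-site colouring. -/

import Mathlib

open scoped ENNReal

/-- The Voronoi cell of the site `p` in the domain `Ω`, for the Euclidean distance. -/
def voronoiCell {n : ℕ} (Ω P : Set (EuclideanSpace ℝ (Fin n))) (p : EuclideanSpace ℝ (Fin n)) :
    Set (EuclideanSpace ℝ (Fin n)) :=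
  {x | x ∈ Ω ∧ ∀ q ∈ P, dist x p ≤ dist x q}

/-- The Delaunay complex of `P` in `Ω`: the nerve of the Voronoi cells, as an abstract simplicial
complex whose simplices are nonempty finite sets of sites. -/
def delaunayComplex {n : ℕ} (Ω P : Set (EuclideanSpace ℝ (Fin n))) :
    Set (Finset (EuclideanSpace ℝ (Fin n))) :=
  {σ | σ.Nonempty ∧ (∀ p ∈ σ, p ∈ P) ∧ (⋂ p ∈ σ, voronoiCell Ω P p).Nonempty}

/-- `P` is an `(ε, μ)`-net of `Ω`: a set of sites of `Ω` that is an `ε`-sample of `Ω` and is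
`μ`-separated. -/
structure IsNet {n : ℕ} (Ω P : Set (EuclideanSpace ℝ (Fin n))) (ε μ : ℝ) : Prop where
  subset : P ⊆ Ω
  sample : ∀ x ∈ Ω, ∃ p ∈ P, dist x p < ε
  separated : ∀ p ∈ P, ∀ q ∈ P, p ≠ q → μ ≤ dist p q

/-- The ball with centre `c` and radius `r` is a Delaunay ball of the simplex `σ`: its centre lies
in `Ω`, its bounding sphere passes through the vertices of `σ`, and no site lies in its interior. -/
structure IsDelaunayBall {n : ℕ} (Ω P : Set (EuclideanSpace ℝ (Fin n)))
    (σ : Finset (EuclideanSpace ℝ (Fin n))) (c : EuclideanSpace ℝ (Fin n)) (r : ℝ) : Prop where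
  center_mem : c ∈ Ω
  circumscribes : ∀ p ∈ σ, dist c p = r
  empty : ∀ q ∈ P, r ≤ dist c q

/-- `P` is `δ`-power protected in `Ω`: every Delaunay simplex `σ`, of any dimension, has a Delaunay
ball `B(c, r)` whose dilation, the closed ball of radius `√(r² + δ²)` about `c`, contains no site
other than the vertices of `σ`. (An `n`-simplex has a single circumscribing ball.) -/
def IsPowerProtected {n : ℕ} (Ω P : Set (EuclideanSpace ℝ (Fin n))) (δ : ℝ) : Prop :=
  ∀ σ ∈ delaunayComplex Ω P, ∃ (c : EuclideanSpace ℝ (Fin n)) (r : ℝ),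
    IsDelaunayBall Ω P σ c r ∧
      ∀ q ∈ P, q ∉ σ → q ∉ Metric.closedBall c (Real.sqrt (r ^ 2 + δ ^ 2))

/-- The geometric simplicial complex `C` is a canvas of `Ω`, that is a triangulation of `Ω`, locally
finite in `Ω`. As `Ω` is open, the simplices may fill exactly `Ω` (with infinitely many simplices),
or its closure, or `Ω` together with a part of its frontier. -/
structure IsCanvas {n : ℕ} (Ω : Set (EuclideanSpace ℝ (Fin n)))
    (C : Geometry.SimplicialComplex ℝ (EuclideanSpace ℝ (Fin n))) : Prop where
  covers : Ω ⊆ C.space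
  space_subset : C.space ⊆ closure Ω
  locallyFinite : ∀ x ∈ Ω, ∃ U ∈ nhds x,
    {s | s ∈ C.faces ∧
      (convexHull ℝ (s : Set (EuclideanSpace ℝ (Fin n))) ∩ U).Nonempty}.Finite

/-- The supremum of the edge lengths of `C`, as an extended nonnegative real. -/
noncomputable def maxEdgeLength {n : ℕ}
    (C : Geometry.SimplicialComplex ℝ (EuclideanSpace ℝ (Fin n))) : ℝ≥0∞ :=
  ⨆ s ∈ C.faces, ⨆ u ∈ s, ⨆ v ∈ s, edist u v

/-- `col` colours each vertex of `C` with a closest site (any one of them in case of a tie); the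
colour of a site is the site itself. -/
def IsNearestSiteColouring {n : ℕ}
    (C : Geometry.SimplicialComplex ℝ (EuclideanSpace ℝ (Fin n)))
    (P : Set (EuclideanSpace ℝ (Fin n)))
    (col : EuclideanSpace ℝ (Fin n) → EuclideanSpace ℝ (Fin n)) : Prop :=
  ∀ v ∈ C.vertices, col v ∈ P ∧ ∀ q ∈ P, dist v (col v) ≤ dist v q

/-- The discrete Voronoi cell of `p`: the union of the (closed) simplices of `C` that have at least
one vertex of colour `p`. -/
def discreteVoronoiCell {n : ℕ}
    (C : Geometry.SimplicialComplex ℝ (EuclideanSpace ℝ (Fin n)))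
    (col : EuclideanSpace ℝ (Fin n) → EuclideanSpace ℝ (Fin n))
    (p : EuclideanSpace ℝ (Fin n)) : Set (EuclideanSpace ℝ (Fin n)) :=
  {x | ∃ s ∈ C.faces, (∃ v ∈ s, col v = p) ∧
    x ∈ convexHull ℝ (s : Set (EuclideanSpace ℝ (Fin n)))}

/-- The discrete Delaunay complex: the nerve of the discrete Voronoi cells of the sites. -/
def discreteDelaunayComplex {n : ℕ}
    (C : Geometry.SimplicialComplex ℝ (EuclideanSpace ℝ (Fin n)))
    (P : Set (EuclideanSpace ℝ (Fin n)))
    (col : EuclideanSpace ℝ (Fin n) → EuclideanSpace ℝ (Fin n)) :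
    Set (Finset (EuclideanSpace ℝ (Fin n))) :=
  {σ | σ.Nonempty ∧ (∀ p ∈ σ, p ∈ P) ∧ (⋂ p ∈ σ, discreteVoronoiCell C col p).Nonempty}

/-! The power difference `dist z q ^ 2 - dist z p ^ 2` is affine in `z`. A point of the discrete
cell of `p` is within one edge length of a vertex coloured `p`, so its squared distance to `p`
exceeds that to any other site by less than `δ ^ 2` (`dist_sq_lt_of_mem_discreteVoronoiCell`). At a
protected centre of `τ`, every site outside `τ` trails those of `τ` by more than `δ ^ 2`. Both
inclusions play these facts against each other.

Discrete implies Delaunay: let `x` be common to the discrete cells of `σ`, `τ` the set of its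
nearest sites, `c` a protected centre of `τ`. Along the ray from `x` away from `c`, the sites of `τ`
stay equidistant, while the gaps of the other sites of `σ` shrink, being above `δ ^ 2` at `c` and
below it at `x`. Stop when a site outside `τ` becomes nearest
(`exists_point_with_additional_nearest`). The span of the nearest sites has grown, so finitely many
moves make all of `σ` nearest. The walk may leave `Ω`; the boundary assumption brings the result
back and supplies the centres.

Delaunay implies discrete: interpolate protected centres of the faces of `σ` multilinearly over the
lower faces of a cube. Convexity of the Voronoi cells keeps the image in `Ω`, and protection keeps
it out of the discrete cell of any site that no contributing face contains. The pulled-back discrete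
cells thus satisfy the covering hypotheses of `nonempty_iInter_of_cover_lower_faces`, which rests on
the absence of a Lipschitz retraction of a ball onto its boundary. -/

/-! ### No Lipschitz retraction onto the sphere, by change of variables -/

section NoRetraction

open MeasureTheory

variable {ι : Type*} [Fintype ι]

/-- The function `t ↦ det (1 + t • A)` is determined by its values at more than `card ι` points, by
Lagrange interpolation. -/
theorem eval_det_one_add_smul_eq_sum (s : Finset ℝ) (hs : Fintype.card ι < s.card)
    (A : (ι → ℝ) →L[ℝ] (ι → ℝ)) (t : ℝ) :
    (1 + t • A).det = ∑ i ∈ s, (1 + i • A).det * (Lagrange.basis s id i).eval t := by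
  classical
  let M : Matrix ι ι ℝ := LinearMap.toMatrix' (A : (ι → ℝ) →ₗ[ℝ] (ι → ℝ))
  let p : Polynomial ℝ :=
    ((Polynomial.X : Polynomial ℝ) • M.map Polynomial.C
      + (1 : Matrix ι ι ℝ).map Polynomial.C).det
  have hp : ∀ t, p.eval t = (1 + t • A).det := by
    intro t
    have h1 : (1 + t • A).det = (1 + t • M).det := by
      rw [ContinuousLinearMap.det, ← LinearMap.det_toMatrix']
      congr 1
      simp [M, LinearMap.toMatrix'_one, ContinuousLinearMap.toLinearMap_one]
    rw [h1, ← Polynomial.coe_evalRingHom, RingHom.map_det]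
    congr 1
    ext i j
    by_cases h : i = j <;> simp [h, add_comm, mul_comm t]
  have hdeg : p.degree < s.card := by
    refine lt_of_le_of_lt Polynomial.degree_le_natDegree ?_
    exact_mod_cast lt_of_le_of_lt (Polynomial.natDegree_det_X_add_C_le M 1) hs
  have h := Lagrange.eq_interpolate (s := s) (v := id) (Set.injOn_id _) hdeg
  rw [← hp, h, Lagrange.interpolate_apply, Polynomial.eval_finsetSum]
  refine Finset.sum_congr rfl fun i _ => ?_
  simp [hp]

/-- The determinant of `1 + s • A` never vanishes on `[0, 1]` and equals 1 at `s = 0`. This removes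
the absolute value from the change of variables formula. -/
theorem det_one_add_pos_of_norm_lt_one {E : Type*} [NormedAddCommGroup E] [NormedSpace ℝ E]
    [FiniteDimensional ℝ E] (A : E →L[ℝ] E) (hA : ‖A‖ < 1) : 0 < (1 + A).det := by
  have hne : ∀ s ∈ Set.Icc (0 : ℝ) 1, (1 + s • A).det ≠ 0 := by
    intro s hs h0
    obtain ⟨v, hv, hv0⟩ := LinearMap.bot_lt_ker_of_det_eq_zero
        (f := ((1 + s • A : E →L[ℝ] E) : E →ₗ[ℝ] E)) h0
      |> (Submodule.ne_bot_iff _).1 ∘ ne_of_gt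
    have h1 : v + s • A v = 0 := by simpa using hv
    have h2 : ‖v‖ ≤ ‖A‖ * ‖v‖ := by
      calc ‖v‖ = s * ‖A v‖ := by
            conv_lhs => rw [eq_neg_of_add_eq_zero_left h1]
            rw [norm_neg, norm_smul, Real.norm_of_nonneg hs.1]
        _ ≤ 1 * ‖A v‖ := by gcongr; exact hs.2
        _ ≤ ‖A‖ * ‖v‖ := by rw [one_mul]; exact A.le_opNorm v
    have h3 : 0 < ‖v‖ := norm_pos_iff.2 hv0
    nlinarith
  have hc : Continuous fun s : ℝ => (1 + s • A).det :=
    ContinuousLinearMap.continuous_det.comp (by fun_prop)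
  by_contra! hle
  obtain ⟨s, hs, h⟩ := intermediate_value_Icc' zero_le_one hc.continuousOn
    (show (0 : ℝ) ∈ Set.Icc _ _ from ⟨by simpa using hle, by simp [ContinuousLinearMap.det]⟩)
  exact hne s hs h

theorem volume_image_eq_zero_of_lipschitz {K : NNReal} {f : (ι → ℝ) → (ι → ℝ)}
    (hf : LipschitzWith K f) {s : Set (ι → ℝ)} (hs : volume s = 0) : volume (f '' s) = 0 := by
  rw [← hausdorffMeasure_pi_real] at hs ⊢
  have h := (hf.lipschitzOnWith (s := s)).hausdorffMeasure_image_le (d := Fintype.card ι)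
    (by positivity)
  rw [hs, mul_zero] at h
  exact le_antisymm h bot_le

theorem bijective_id_add_of_lipschitz {E : Type*} [NormedAddCommGroup E] [CompleteSpace E]
    {K : NNReal} (hK : K < 1) {g : E → E} (hg : LipschitzWith K g) :
    Function.Bijective fun x => x + g x := by
  constructor
  · intro x y hxy
    have h1 : x - y = g y - g x := by
      have : x + g x = y + g y := hxy
      rw [sub_eq_sub_iff_add_eq_add, this, add_comm]
    have h2 := hg.dist_le_mul y x
    rw [dist_eq_norm, ← h1, dist_comm, dist_eq_norm] at h2
    have h3 : (K : ℝ) < 1 := hK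
    by_contra hne
    have h4 : 0 < ‖x - y‖ := norm_pos_iff.2 (sub_ne_zero.2 hne)
    nlinarith
  · intro y
    have hc : ContractingWith K fun x => y - g x := by
      refine ⟨hK, LipschitzWith.of_dist_le_mul fun a b => ?_⟩
      rw [dist_sub_left]
      exact hg.dist_le_mul a b
    have h := hc.fixedPoint_isFixedPt
    refine ⟨hc.fixedPoint, ?_⟩
    have h' : y - g hc.fixedPoint = hc.fixedPoint := h
    exact (eq_add_of_sub_eq h').symm

theorem image_ball_id_add_of_bijective {E : Type*} [NormedAddCommGroup E] {g : E → E} {R : ℝ}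
    (hb : Function.Bijective fun x => x + g x) (h0 : ∀ x, R ≤ ‖x‖ → g x = 0) :
    (fun x => x + g x) '' Metric.ball 0 R = Metric.ball 0 R := by
  ext y
  constructor
  · rintro ⟨x, hx, rfl⟩
    by_contra hy
    have hy' : R ≤ ‖x + g x‖ := by simpa using hy
    have : (x + g x) + g (x + g x) = x + g x := by rw [h0 _ hy', add_zero]
    have h := hb.1 (a₁ := x + g x) (a₂ := x) this
    rw [h] at hy'
    exact absurd hy' (by simpa using hx)
  · intro hy
    obtain ⟨x, rfl⟩ := hb.2 y
    refine ⟨x, ?_, rfl⟩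
    by_contra hx
    have hx' : R ≤ ‖x‖ := by simpa using hx
    simp only [h0 x hx', add_zero] at hy
    exact hx hy

/-- If `g` is Lipschitz with a small constant and vanishes outside a ball, then `id + g` maps the
ball onto itself and its Jacobian determinant integrates to the volume of the ball. -/
theorem integral_det_one_add_fderiv_of_lipschitz {K : NNReal} (hK : K < 1)
    {g : (ι → ℝ) → (ι → ℝ)} (hg : LipschitzWith K g) {R : ℝ} (h0 : ∀ x, R ≤ ‖x‖ → g x = 0) :
    IntegrableOn (fun x => (1 + fderiv ℝ g x).det) (Metric.ball 0 R) ∧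
      ∫ x in Metric.ball 0 R, (1 + fderiv ℝ g x).det = volume.real (Metric.ball (0 : ι → ℝ) R) := by
  set B := Metric.ball (0 : ι → ℝ) R with hB
  set D := {x | DifferentiableAt ℝ g x} with hD
  set f : (ι → ℝ) → (ι → ℝ) := fun x => x + g x with hf
  have hDm : MeasurableSet D := measurableSet_of_differentiableAt ℝ g
  have hDae : ∀ᵐ x, x ∈ D := hg.ae_differentiableAt
  have hSm : MeasurableSet (B ∩ D) := measurableSet_ball.inter hDm
  have hbij : Function.Bijective f := bijective_id_add_of_lipschitz hK hg
  have hlip : LipschitzWith (1 + K) f := LipschitzWith.id.add hg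
  have hae : (B ∩ D : Set (ι → ℝ)) =ᵐ[volume] B := by
    refine inter_ae_eq_left_of_ae_eq_univ ?_
    exact Filter.eventuallyEq_univ.2 hDae
  have himg : volume (f '' (B ∩ D)) = volume B := by
    refine le_antisymm ?_ ?_
    · exact (measure_mono (Set.image_mono Set.inter_subset_left)).trans_eq
        (by rw [image_ball_id_add_of_bijective hbij h0])
    · have h1 : volume (f '' (B \ D)) = 0 :=
        volume_image_eq_zero_of_lipschitz hlip (measure_mono_null (Set.sdiff_subset_compl B D) hDae)
      calc volume B = volume (f '' B) := by rw [image_ball_id_add_of_bijective hbij h0]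
        _ = volume (f '' (B ∩ D) ∪ f '' (B \ D)) := by
          rw [← Set.image_union, Set.inter_union_sdiff]
        _ ≤ _ := (measure_union_le _ _).trans_eq (by rw [h1, add_zero])
  have hder : ∀ x ∈ B ∩ D, HasFDerivWithinAt f (1 + fderiv ℝ g x) (B ∩ D) x := fun x hx =>
    ((hasFDerivAt_id x).add hx.2.hasFDerivAt).hasFDerivWithinAt
  have hpos : ∀ x, |(1 + fderiv ℝ g x).det| = (1 + fderiv ℝ g x).det := fun x =>
    abs_of_pos (det_one_add_pos_of_norm_lt_one _
      ((norm_fderiv_le_of_lipschitz ℝ hg).trans_lt hK))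
  have hfin : volume B ≠ ∞ := measure_ball_lt_top.ne
  constructor
  · rw [← integrableOn_congr_set_ae hae]
    have h1 := (integrableOn_image_iff_integrableOn_abs_det_fderiv_smul volume hSm hder
      hbij.1.injOn (fun _ => (1 : ℝ))).1 (integrableOn_const (by rw [himg]; exact hfin))
    simpa [hpos] using h1
  · rw [← setIntegral_congr_set hae]
    have h1 := integral_image_eq_integral_abs_det_fderiv_smul volume hSm hder
      hbij.1.injOn (fun _ => (1 : ℝ))
    simp only [hpos, smul_eq_mul, mul_one] at h1
    rw [← h1]
    simp [Measure.real, himg]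

theorem integral_det_one_add_fderiv {K : NNReal} {g : (ι → ℝ) → (ι → ℝ)} (hg : LipschitzWith K g)
    {R : ℝ} (h0 : ∀ x, R ≤ ‖x‖ → g x = 0) :
    ∫ x in Metric.ball 0 R, (1 + fderiv ℝ g x).det = volume.real (Metric.ball (0 : ι → ℝ) R) := by
  set N := Fintype.card ι + 1 with hN
  -- Distinct parameters small enough that `v i • g` is a contraction. The integral of the
  -- determinant is polynomial in the parameter, so its values there determine it at 1.
  let v : ℕ → ℝ := fun i => (1 : ℝ) / ((K + 1) * (i + 2))
  have hv0 : ∀ i, 0 < v i := fun i => by positivity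
  have hvK : ∀ i, K * v i < 1 := fun i => by
    have hK := K.coe_nonneg
    simp only [v]
    rw [mul_one_div, div_lt_one (by positivity)]
    nlinarith [(Nat.cast_nonneg i : (0 : ℝ) ≤ i)]
  have hvinj : Function.Injective v := by
    intro i j hij
    have hK := K.coe_nonneg
    simp only [v] at hij
    rw [div_eq_div_iff (by positivity) (by positivity), one_mul, one_mul] at hij
    have := mul_left_cancel₀ (by positivity) hij
    have h : (i : ℝ) = j := by linarith
    exact_mod_cast h
  set s : Finset ℝ := (Finset.range N).image v with hs
  have hcard : s.card = N := by
    rw [hs, Finset.card_image_of_injective _ hvinj, Finset.card_range]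
  have hmem : ∀ t ∈ s, IntegrableOn (fun x => (1 + t • fderiv ℝ g x).det) (Metric.ball 0 R) ∧
      ∫ x in Metric.ball 0 R, (1 + t • fderiv ℝ g x).det
        = volume.real (Metric.ball (0 : ι → ℝ) R) := by
    intro t ht
    obtain ⟨i, -, rfl⟩ := Finset.mem_image.1 ht
    have hlip : LipschitzWith (‖v i‖₊ * K) fun x => v i • g x := (lipschitzWith_smul (v i)).comp hg
    have h := integral_det_one_add_fderiv_of_lipschitz (g := fun x => v i • g x)
      (K := ‖v i‖₊ * K) ?_ hlip (R := R) (fun x hx => by simp [h0 x hx])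
    · have hfd : ∀ x, fderiv ℝ (fun x => v i • g x) x = v i • fderiv ℝ g x := fun x =>
        
        congrFun (fderiv_const_smul_field (f := g) (v i)) x
      simpa only [hfd] using h
    · rw [← NNReal.coe_lt_coe]
      push_cast
      rw [Real.norm_of_nonneg (hv0 i).le, mul_comm]
      exact hvK i
  have hcd : Fintype.card ι < s.card := by rw [hcard]; exact Nat.lt_succ_self _
  have hexp : ∀ x, (1 + fderiv ℝ g x).det
      = ∑ i ∈ s, (1 + i • fderiv ℝ g x).det * (Lagrange.basis s id i).eval 1 := fun x => by
    have := eval_det_one_add_smul_eq_sum s hcd (fderiv ℝ g x) 1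
    rwa [one_smul] at this
  simp_rw [hexp]
  rw [integral_finsetSum _ fun i hi => (hmem i hi).1.mul_const _]
  simp_rw [integral_mul_const]
  rw [Finset.sum_congr rfl fun i hi => by rw [(hmem i hi).2], ← Finset.mul_sum,
    ← Polynomial.eval_finsetSum, Lagrange.sum_basis (Set.injOn_id _)
      (Finset.card_pos.1 (by omega))]
  simp

/-- Otherwise some direction `h` has `A h = f x`, and moving along `h` multiplies the norm of `f` by
`1 + t` to first order. This argument suits any norm, in particular the sup norm, which need not be
differentiable. -/
theorem det_eq_zero_of_norm_eq {E : Type*} [NormedAddCommGroup E] [NormedSpace ℝ E]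
    [FiniteDimensional ℝ E] {f : E → E} {A : E →L[ℝ] E} {x : E} {R : ℝ} (hR : 0 < R)
    (hf : HasFDerivAt f A x) (hn : ∀ᶠ y in nhds x, ‖f y‖ = R) : A.det = 0 := by
  by_contra hdet
  have hsurj : Function.Surjective A := by
    have hu : IsUnit (LinearMap.det (A : E →ₗ[ℝ] E)) := isUnit_iff_ne_zero.2 hdet
    exact ((Module.End.isUnit_iff _).1 ((LinearMap.isUnit_iff_isUnit_det _).2 hu)).2
  obtain ⟨h, hh⟩ := hsurj (f x)
  have hline : HasDerivAt (fun t : ℝ => f (x + t • h)) (f x) 0 := by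
    have h1 : HasDerivAt (fun t : ℝ => x + t • h) h 0 := by
      simpa using ((hasDerivAt_id (0 : ℝ)).smul_const h).const_add x
    have h2 : HasFDerivAt f A (x + (0 : ℝ) • h) := by simpa using hf
    have := h2.comp_hasDerivAt (0 : ℝ) h1
    rwa [hh] at this
  have hfx : ‖f x‖ = R := hn.self_of_nhds
  have hlo := hline.isLittleO.def (half_pos hR)
  have hcont : Filter.Tendsto (fun t : ℝ => x + t • h) (nhds 0) (nhds x) := by
    have : Continuous fun t : ℝ => x + t • h := by fun_prop
    simpa using this.tendsto 0
  have hev := (hlo.and (hcont.eventually hn)).filter_mono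
    (nhdsWithin_le_nhds (s := Set.Ioi (0 : ℝ)))
  obtain ⟨t, ⟨h1, h2⟩, ht⟩ := (hev.and self_mem_nhdsWithin).exists
  have ht' : (0 : ℝ) < t := ht
  simp only [zero_smul, add_zero, sub_zero, Real.norm_of_nonneg ht'.le] at h1
  have h3 : ‖(1 + t) • f x‖ ≤ ‖f (x + t • h)‖ + ‖f (x + t • h) - f x - t • f x‖ := by
    have : (1 + t) • f x = f (x + t • h) - (f (x + t • h) - f x - t • f x) := by
      rw [add_smul, one_smul]; abel
    rw [this]
    exact norm_sub_le _ _
  rw [h2, norm_smul, hfx, Real.norm_of_nonneg (by positivity)] at h3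
  nlinarith [mul_pos ht' hR]

/-- There is no Lipschitz retraction of a ball onto its boundary. -/
theorem not_norm_id_add_eq_of_lipschitz {K : NNReal} {g : (ι → ℝ) → (ι → ℝ)}
    (hg : LipschitzWith K g) {R : ℝ} (hR : 0 < R) (h0 : ∀ x, R ≤ ‖x‖ → g x = 0) :
    ¬ ∀ x, ‖x‖ ≤ R → ‖x + g x‖ = R := by
  intro hall
  have h1 := integral_det_one_add_fderiv hg h0
  have h2 : ∫ x in Metric.ball 0 R, (1 + fderiv ℝ g x).det = 0 := by
    refine integral_eq_zero_of_ae ((ae_restrict_iff' measurableSet_ball).2 ?_)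
    filter_upwards [hg.ae_differentiableAt] with x hx hxB
    refine det_eq_zero_of_norm_eq (f := fun x => x + g x) hR
      ((hasFDerivAt_id x).add hx.hasFDerivAt) ?_
    filter_upwards [Metric.isOpen_ball.mem_nhds hxB] with y hy
    exact hall y (by simpa using (Metric.mem_ball.1 hy).le)
  rw [h2] at h1
  exact absurd h1.symm (ENNReal.toReal_pos (Metric.measure_ball_pos volume _ hR).ne'
    measure_ball_lt_top.ne).ne'

/-- Radial rescaling `x ↦ x / max m ‖x‖` is Lipschitz. -/
theorem lipschitzWith_inv_max_norm_smul {E : Type*} [NormedAddCommGroup E] [NormedSpace ℝ E]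
    {m : ℝ} (hm : 0 < m) :
    LipschitzWith (2 / m).toNNReal fun x : E => (max m ‖x‖)⁻¹ • x := by
  refine LipschitzWith.of_dist_le_mul fun x y => ?_
  rw [Real.coe_toNNReal _ (by positivity), dist_eq_norm, dist_eq_norm]
  set a := max m ‖x‖ with ha
  set b := max m ‖y‖ with hb
  have ha0 : m ≤ a := le_max_left _ _
  have hb0 : m ≤ b := le_max_left _ _
  have hap : 0 < a := hm.trans_le ha0
  have hbp : 0 < b := hm.trans_le hb0
  have hyb : ‖y‖ ≤ b := le_max_right _ _
  have hab : |b - a| ≤ ‖x - y‖ := by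
    refine (abs_max_sub_max_le_max _ _ _ _).trans ?_
    simp only [sub_self, abs_zero]
    rw [max_eq_right (abs_nonneg _), norm_sub_rev]
    exact abs_norm_sub_norm_le _ _
  have hdec : a⁻¹ • x - b⁻¹ • y = a⁻¹ • (x - y) + ((b - a) * a⁻¹ * b⁻¹) • y := by
    have : a⁻¹ - b⁻¹ = (b - a) * a⁻¹ * b⁻¹ := by field_simp
    rw [← this, smul_sub, sub_smul]; abel
  rw [hdec]
  refine (norm_add_le _ _).trans ?_
  rw [norm_smul, norm_smul, norm_mul, norm_mul, Real.norm_of_nonneg (inv_pos.2 hap).le,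
    Real.norm_of_nonneg (inv_pos.2 hbp).le, Real.norm_eq_abs]
  have h1 : a⁻¹ ≤ m⁻¹ := inv_anti₀ hm ha0
  have h2 : b⁻¹ * ‖y‖ ≤ 1 := by
    rw [inv_mul_le_iff₀ hbp]; simpa using hyb
  have h3 : |b - a| * a⁻¹ ≤ ‖x - y‖ * m⁻¹ := by gcongr
  have h4 : |b - a| * a⁻¹ * b⁻¹ * ‖y‖ ≤ ‖x - y‖ * m⁻¹ := by
    rw [mul_assoc _ b⁻¹]
    exact (mul_le_of_le_one_right (by positivity) h2).trans h3
  have h5 : a⁻¹ * ‖x - y‖ ≤ m⁻¹ * ‖x - y‖ := by gcongr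
  calc _ ≤ m⁻¹ * ‖x - y‖ + ‖x - y‖ * m⁻¹ := add_le_add h5 h4
    _ = 2 / m * ‖x - y‖ := by ring

/-- A Lipschitz self-map of `ℝ^ι` that is the identity outside a ball has a zero. -/
theorem exists_eq_zero_of_lipschitz_of_eq_id_outside_ball {K : NNReal} {f : (ι → ℝ) → (ι → ℝ)}
    (hf : LipschitzWith K f) {R : ℝ} (hR : 0 < R) (hid : ∀ x, R ≤ ‖x‖ → f x = x) :
    ∃ x, f x = 0 := by
  by_contra! hne
  obtain ⟨x₀, -, hx₀⟩ := (isCompact_closedBall (0 : ι → ℝ) R).exists_isMinOn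
    ⟨0, by simp [hR.le]⟩ (hf.continuous.norm.continuousOn)
  set m := min R ‖f x₀‖ with hm
  have hm0 : 0 < m := lt_min hR (norm_pos_iff.2 (hne x₀))
  have hmf : ∀ x, m ≤ ‖f x‖ := by
    intro x
    rcases le_total ‖x‖ R with h | h
    · exact (min_le_right _ _).trans (hx₀ (by simpa using h))
    · rw [hid x h]; exact (min_le_left _ _).trans h
  -- If `f` has no zero, `R • q` is a Lipschitz retraction of the ball onto its boundary.
  -- Subtracting `R • p` yields a perturbation of the identity that vanishes outside the ball.
  let q : (ι → ℝ) → (ι → ℝ) := fun x => (max m ‖f x‖)⁻¹ • f x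
  let p : (ι → ℝ) → (ι → ℝ) := fun x => (max R ‖x‖)⁻¹ • x
  have hq : LipschitzWith _ q := (lipschitzWith_inv_max_norm_smul hm0).comp hf
  have hp : LipschitzWith _ p := lipschitzWith_inv_max_norm_smul hR
  have hg : LipschitzWith _ fun x => R • q x - R • p x :=
    ((lipschitzWith_smul R).comp hq).sub ((lipschitzWith_smul R).comp hp)
  refine not_norm_id_add_eq_of_lipschitz hg hR ?_ ?_
  · intro x hx
    have h1 : max m ‖f x‖ = ‖x‖ := by rw [max_eq_right (hmf x), hid x hx]
    have h2 : max R ‖x‖ = ‖x‖ := max_eq_right hx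
    simp only [q, p, h1, h2]
    rw [hid x hx, sub_self]
  · intro x hx
    have h2 : max R ‖x‖ = R := max_eq_left hx
    have h1 : max m ‖f x‖ = ‖f x‖ := max_eq_right (hmf x)
    have h3 : R • p x = x := by simp only [p, h2, smul_inv_smul₀ hR.ne']
    have h4 : ‖f x‖ ≠ 0 := norm_ne_zero_iff.2 (hne x)
    simp only [h3, add_sub_cancel, q, h1]
    rw [norm_smul, norm_smul, norm_inv, norm_norm, inv_mul_cancel₀ h4, mul_one,
      Real.norm_of_nonneg hR.le]

end NoRetraction

/-! ### A covering theorem of KKM type on the cube -/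

section KKM

/-- `h` may be unbounded, but if one of the two points lies in the ball, the product rule can be
arranged so that `h` is evaluated there. -/
theorem LipschitzWith.smul_of_eq_zero_outside_ball {E F : Type*} [NormedAddCommGroup E]
    [NormedAddCommGroup F] [NormedSpace ℝ F] {K L : NNReal} {u : E → ℝ} {h : E → F}
    (hu : LipschitzWith K u) (hh : LipschitzWith L h) {R : ℝ}
    (hu1 : ∀ x, |u x| ≤ 1) (hu0 : ∀ x, R ≤ ‖x‖ → u x = 0) :
    ∃ M, LipschitzWith M fun x => u x • h x := by
  set C : ℝ := ‖h 0‖ + L * |R| with hC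
  have hC0 : 0 ≤ C := by positivity
  have hb : ∀ x, ‖x‖ ≤ R → ‖h x‖ ≤ C := by
    intro x hx
    have h1 : ‖h x‖ ≤ ‖h 0‖ + ‖h x - h 0‖ := norm_le_norm_add_norm_sub' _ _
    have h2 := hh.dist_le_mul x 0
    rw [dist_eq_norm, dist_zero_right] at h2
    have h3 : (L : ℝ) * ‖x‖ ≤ L * |R| := by
      gcongr
      exact hx.trans (le_abs_self R)
    linarith
  have key : ∀ x y, ‖x‖ ≤ R → dist (u x • h x) (u y • h y) ≤ (K * C + L) * dist x y := by
    intro x y hx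
    have h1 : u x • h x - u y • h y = (u x - u y) • h x + u y • (h x - h y) := by
      rw [sub_smul, smul_sub]; abel
    rw [dist_eq_norm, h1]
    refine (norm_add_le _ _).trans ?_
    rw [norm_smul, norm_smul, Real.norm_eq_abs, Real.norm_eq_abs]
    have h2 := hu.dist_le_mul x y
    have h3 := hh.dist_le_mul x y
    rw [Real.dist_eq] at h2
    rw [dist_eq_norm (h x)] at h3
    calc |u x - u y| * ‖h x‖ + |u y| * ‖h x - h y‖
        ≤ (K * dist x y) * C + 1 * (L * dist x y) := by
          gcongr
          · exact hb x hx
          · exact hu1 y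
      _ = _ := by ring
  refine ⟨K * C.toNNReal + L, LipschitzWith.of_dist_le_mul fun x y => ?_⟩
  push_cast
  rw [Real.coe_toNNReal _ hC0]
  rcases le_total ‖x‖ R with hx | hx
  · exact key x y hx
  rcases le_total ‖y‖ R with hy | hy
  · rw [dist_comm, dist_comm x]
    exact key y x hy
  · rw [hu0 x hx, hu0 y hy, zero_smul, zero_smul, dist_self]
    positivity

variable {ι : Type*} [Fintype ι] [Nonempty ι]

theorem lipschitzWith_iInf_pi : LipschitzWith 1 fun a : ι → ℝ => ⨅ i, a i := by
  refine LipschitzWith.of_le_add fun a b => ?_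
  rw [← sub_le_iff_le_add]
  refine le_ciInf fun i => ?_
  rw [sub_le_iff_le_add]
  refine (ciInf_le (Set.finite_range a).bddBelow i).trans ?_
  have h := (Real.dist_eq _ _ ▸ dist_le_pi_dist a b i)
  linarith [le_abs_self (a i - b i)]

/-- This map sends the whole space to the lower faces of the unit cube: subtract the minimum, then
truncate at 1. -/
theorem lipschitzWith_min_sub_iInf :
    LipschitzWith 2 fun (a : ι → ℝ) (i : ι) => min (a i - ⨅ j, a j) 1 := by
  refine LipschitzWith.of_dist_le_mul fun a b => ?_
  refine (dist_pi_le_iff (by positivity)).2 fun i => ?_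
  have h1 := lipschitzWith_iInf_pi.dist_le_mul a b
  have h2 := dist_le_pi_dist a b i
  rw [Real.dist_eq] at h1 h2 ⊢
  have h3 := abs_min_sub_min_le_max (a i - ⨅ j, a j) 1 (b i - ⨅ j, b j) 1
  rw [sub_self, abs_zero, max_eq_left (abs_nonneg _)] at h3
  refine h3.trans ?_
  have h4 : a i - (⨅ j, a j) - (b i - ⨅ j, b j) = (a i - b i) - ((⨅ j, a j) - ⨅ j, b j) := by
    ring
  rw [h4]
  refine (abs_sub _ _).trans ?_
  push_cast at h1 ⊢
  linarith

/-- A covering theorem of Knaster–Kuratowski–Mazurkiewicz type: if closed sets `B i` cover the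
lower faces of the unit cube and `B i` avoids the upper face in direction `i`, then the sets have
a common point. -/
theorem nonempty_iInter_of_cover_lower_faces (B : ι → Set (ι → ℝ)) (hB : ∀ i, IsClosed (B i))
    (hcov : ∀ a : ι → ℝ, (∀ i, 0 ≤ a i ∧ a i ≤ 1) → (∃ i, a i = 0) → ∃ i, a ∈ B i)
    (hne : ∀ i, ∀ a ∈ B i, a i ≠ 1) : (⋂ i, B i).Nonempty := by
  classical
  have hBne : ∀ i, (B i).Nonempty := by
    intro i
    -- All coordinates but the `i`-th are 1, so only `B i` can contain this point.
    obtain ⟨j, hj⟩ := hcov (Function.update 1 i 0)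
      (fun k => by by_cases hk : k = i <;> simp [Function.update, hk]) ⟨i, by simp⟩
    have : j = i := by
      by_contra hji
      exact hne j _ hj (by simp [hji])
    exact ⟨_, this ▸ hj⟩
  obtain ⟨o⟩ := ‹Nonempty ι›
  have : Nonempty ι := ⟨o⟩
  let l : (ι → ℝ) → ι → ℝ := fun a i => min (a i - ⨅ j, a j) 1
  have hl : LipschitzWith 2 l := lipschitzWith_min_sub_iInf
  let d : (ι → ℝ) → ι → ℝ := fun a i => Metric.infDist (l a) (B i)
  have hd : LipschitzWith 2 d := by
    refine LipschitzWith.of_dist_le_mul fun a b => ?_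
    refine (dist_pi_le_iff (by positivity)).2 fun i => ?_
    have h1 := (Metric.lipschitz_infDist_pt (B i)).dist_le_mul (l a) (l b)
    rw [NNReal.coe_one, one_mul] at h1
    exact h1.trans (hl.dist_le_mul a b)
  have hev : LipschitzWith 1 fun (a : ι → ℝ) (_ : ι) => a o :=
    LipschitzWith.of_dist_le_mul fun a b => by
      rw [NNReal.coe_one, one_mul]
      exact (dist_pi_le_iff dist_nonneg).2 fun _ => dist_le_pi_dist a b o
  -- Where the cut-off `u` is 1, the map `a + u a • h a` has coordinates `d a i - d a o + a o`. A
  -- zero there has `a o = 0` and all distances equal.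
  let h : (ι → ℝ) → ι → ℝ := fun a => d a - (fun _ => d a o) + (fun _ => a o) - a
  have hh : LipschitzWith _ h := ((hd.sub (hev.comp hd)).add hev).sub LipschitzWith.id
  let u : (ι → ℝ) → ℝ := fun a => max 0 (min 1 (2 - ‖a‖))
  have hu : LipschitzWith 1 u := by
    have h1 : LipschitzWith 1 fun a : ι → ℝ => 2 - ‖a‖ := by
      simpa using (LipschitzWith.const (2 : ℝ)).sub (lipschitzWith_one_norm (E := ι → ℝ))
    exact (h1.const_min 1).const_max 0
  have hu0 : ∀ a, 0 ≤ u a := fun a => le_max_left _ _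
  have hu1 : ∀ a, u a ≤ 1 := fun a => max_le zero_le_one (min_le_left _ _)
  have hsupp : ∀ a : ι → ℝ, 2 ≤ ‖a‖ → u a = 0 := fun a ha =>
    max_eq_left ((min_le_right _ _).trans (by linarith))
  obtain ⟨M, hM⟩ := hu.smul_of_eq_zero_outside_ball hh (R := 2)
    (fun a => abs_le.2 ⟨by linarith [hu0 a], hu1 a⟩) hsupp
  obtain ⟨a, ha⟩ := exists_eq_zero_of_lipschitz_of_eq_id_outside_ball (LipschitzWith.id.add hM)
    (R := 2) two_pos (fun x hx => by simp [hsupp x hx])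
  have ha' : ∀ i, a i + u a * (d a i - d a o + a o - a i) = 0 := fun i => congrFun ha i
  have hao : a o = 0 := by simpa using ha' o
  have hmin : ∀ i, ⨅ j, a j ≤ a i := fun i => ciInf_le (Set.finite_range a).bddBelow i
  obtain ⟨k, hk⟩ := exists_eq_ciInf_of_finite (f := a)
  obtain ⟨j, hj⟩ := hcov (l a)
    (fun i => ⟨le_min (sub_nonneg.2 (hmin i)) zero_le_one, min_le_right _ _⟩)
    ⟨k, by simp [l, hk]⟩
  have hdj : d a j = 0 := ((hB j).mem_iff_infDist_zero (hBne j)).1 hj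
  have hdn : ∀ i, 0 ≤ d a i := fun i => Metric.infDist_nonneg
  -- If no coordinate is truncated, `a o = 0` puts `a` where `u = 1`; the distances are equal and
  -- one is zero, so all vanish. A truncated coordinate `i` has `d a i > 0` and `a i > a j`, so
  -- equations `i` and `j` conflict.
  by_cases hlt : ∀ i, a i - ⨅ j, a j < 1
  · have hnorm : ‖a‖ ≤ 1 := by
      refine (pi_norm_le_iff_of_nonneg zero_le_one).2 fun i => ?_
      have h1 := hlt i
      have h2 := hlt o
      have h3 := hmin i
      have h4 := hmin o
      rw [Real.norm_eq_abs, abs_le]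
      constructor <;> linarith
    have hua : u a = 1 := by
      simp only [u]
      rw [min_eq_left (by linarith), max_eq_right zero_le_one]
    have hdo : d a o = 0 := by
      have := ha' j
      rw [hua, hdj, hao] at this
      linarith
    refine ⟨l a, Set.mem_iInter.2 fun i => ((hB i).mem_iff_infDist_zero (hBne i)).2 ?_⟩
    have := ha' i
    rw [hua, hdo, hao] at this
    change d a i = 0
    linarith
  · push Not at hlt
    obtain ⟨i, hi⟩ := hlt
    have hli : l a i = 1 := min_eq_right hi
    have hdi : 0 < d a i := by
      refine (hdn i).lt_of_ne fun h0 => ?_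
      exact hne i _ (((hB i).mem_iff_infDist_zero (hBne i)).2 h0.symm) hli
    have hlj : a j - ⨅ j, a j < 1 := by
      by_contra! hge
      exact hne j _ hj (min_eq_right hge)
    have h1 := ha' i
    have h2 := ha' j
    rw [hdj] at h2
    have h3 : (1 - u a) * (a i - a j) + u a * d a i = 0 := by linarith
    have h4 : 0 < a i - a j := by linarith
    rcases (hu0 a).eq_or_lt with h5 | h5
    · rw [← h5] at h3
      linarith
    · nlinarith [mul_pos h5 hdi, mul_nonneg (sub_nonneg.2 (hu1 a)) h4.le]

end KKM

/-! ### Power differences and the walk away from protected centres -/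

section PowerDifference

variable {V : Type*} [NormedAddCommGroup V] [InnerProductSpace ℝ V]

/-- The term `‖z‖ ^ 2` cancels, leaving an affine function of `z`. -/
theorem dist_sq_sub_dist_sq (z p q : V) :
    dist z q ^ 2 - dist z p ^ 2 = ‖q‖ ^ 2 - ‖p‖ ^ 2 - 2 * inner ℝ z (q - p) := by
  rw [dist_eq_norm, dist_eq_norm, norm_sub_sq_real, norm_sub_sq_real, inner_sub_right]
  ring

theorem dist_sq_sub_dist_sq_add_smul_sub (x c p q : V) (t : ℝ) :
    dist (x + t • (x - c)) q ^ 2 - dist (x + t • (x - c)) p ^ 2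
      = (1 + t) * (dist x q ^ 2 - dist x p ^ 2) - t * (dist c q ^ 2 - dist c p ^ 2) := by
  simp only [dist_sq_sub_dist_sq, inner_add_left, inner_smul_left, inner_sub_left,
    RCLike.conj_to_real]
  ring

theorem dist_sq_sub_dist_sq_sum {ι : Type*} (s : Finset ι) (w : ι → ℝ) (z : ι → V)
    (hw : ∑ i ∈ s, w i = 1) (p q : V) :
    dist (∑ i ∈ s, w i • z i) q ^ 2 - dist (∑ i ∈ s, w i • z i) p ^ 2
      = ∑ i ∈ s, w i * (dist (z i) q ^ 2 - dist (z i) p ^ 2) := by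
  simp only [dist_sq_sub_dist_sq, sum_inner, inner_smul_left, RCLike.conj_to_real]
  simp only [mul_sub, Finset.sum_sub_distrib, ← Finset.sum_mul, hw, one_mul, Finset.mul_sum]
  congr 1
  exact Finset.sum_congr rfl fun i _ => by ring

theorem le_dist_sq_sub_dist_sq_sum {ι : Type*} (s : Finset ι) (w : ι → ℝ) (z : ι → V)
    (hw : ∑ i ∈ s, w i = 1) (hw0 : ∀ i ∈ s, 0 ≤ w i) (p q : V) (b : ℝ)
    (h : ∀ i ∈ s, w i ≠ 0 → b ≤ dist (z i) q ^ 2 - dist (z i) p ^ 2) :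
    b ≤ dist (∑ i ∈ s, w i • z i) q ^ 2 - dist (∑ i ∈ s, w i • z i) p ^ 2 := by
  rw [dist_sq_sub_dist_sq_sum s w z hw]
  calc b = ∑ i ∈ s, w i * b := by rw [← Finset.sum_mul, hw, one_mul]
    _ ≤ _ := Finset.sum_le_sum fun i hi => by
      by_cases h0 : w i = 0
      · simp [h0]
      · exact mul_le_mul_of_nonneg_left (h i hi h0) (hw0 i hi)

theorem finite_of_pairwise_le_dist_of_subset_closedBall [FiniteDimensional ℝ V] {P S : Set V}
    {μ : ℝ} (hμ : 0 < μ) (hP : P.Pairwise fun p q => μ ≤ dist p q) (hS : S ⊆ P) {x : V} {r : ℝ}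
    (hr : S ⊆ Metric.closedBall x r) : S.Finite := by
  have : ProperSpace V := FiniteDimensional.proper ℝ V
  have hd : IsDiscrete P := ⟨DiscreteTopology.of_forall_le_dist hμ fun a b hab =>
    hP a.2 b.2 (Subtype.coe_injective.ne hab)⟩
  exact (Metric.finite_isBounded_inter_isClosed hd Metric.isBounded_closedBall
    (Metric.isClosed_of_pairwise_le_dist hμ hP)).subset fun p hp => ⟨hr hp, hS hp⟩

theorem exists_forall_dist_le_of_pairwise_le_dist [FiniteDimensional ℝ V] {P : Set V} {μ : ℝ}
    (hμ : 0 < μ) (hP : P.Pairwise fun p q => μ ≤ dist p q) (hne : P.Nonempty) (x : V) :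
    ∃ p ∈ P, ∀ q ∈ P, dist x p ≤ dist x q := by
  obtain ⟨p₀, hp₀⟩ := hne
  obtain ⟨p, hp, hmin⟩ := Set.exists_min_image (P ∩ Metric.closedBall x (dist x p₀)) (dist x)
    (finite_of_pairwise_le_dist_of_subset_closedBall hμ hP Set.inter_subset_left
      Set.inter_subset_right) ⟨p₀, hp₀, by simp [dist_comm]⟩
  refine ⟨p, hp.1, fun q hq => ?_⟩
  by_cases h : dist x q ≤ dist x p₀
  · exact hmin q ⟨hq, by simpa [dist_comm] using h⟩
  · exact (hmin p₀ ⟨hp₀, by simp [dist_comm]⟩).trans (not_le.1 h).le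

/-- Moving `x` away from a protected centre `c` of the set `τ` of the sites nearest to `x`, one
reaches a point at which a further site is nearest, and the power gaps of the sites of `σ` do not
grow. -/
theorem exists_point_with_additional_nearest [FiniteDimensional ℝ V] {P : Set V} {μ δ : ℝ}
    (hμ : 0 < μ) (hP : P.Pairwise fun p q => μ ≤ dist p q) {σ τ : Set V} {x c : V}
    (hσP : σ ⊆ P) (hτP : τ ⊆ P) (hτ : ∀ p ∈ τ, ∀ q ∈ P, dist x p ≤ dist x q)
    (hc : ∀ p ∈ τ, ∀ q ∈ P, dist c p ≤ dist c q)
    (hcδ : ∀ p ∈ τ, ∀ q ∈ P, q ∉ τ → dist c p ^ 2 + δ ^ 2 < dist c q ^ 2)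
    (hx : ∀ p ∈ σ, ∀ q ∈ P, dist x p ^ 2 < dist x q ^ 2 + δ ^ 2)
    {p₀ : V} (hp₀ : p₀ ∈ τ) {p₁ : V} (hp₁ : p₁ ∈ σ) (hp₁τ : p₁ ∉ τ) :
    ∃ y, ∃ q ∈ P, q ∉ τ ∧ (∀ q' ∈ P, dist y q ≤ dist y q') ∧
      (∀ p ∈ τ, ∀ q' ∈ P, dist y p ≤ dist y q') ∧
      ∀ p ∈ σ, ∀ q' ∈ P, dist y p ^ 2 < dist y q' ^ 2 + δ ^ 2 := by
  have hp₀P := hτP hp₀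
  let a : V → ℝ := fun q => dist x q ^ 2 - dist x p₀ ^ 2
  let k : V → ℝ := fun q => dist c q ^ 2 - dist c p₀ ^ 2
  let b : V → ℝ := fun q => k q - a q
  let pt : ℝ → V := fun t => x + t • (x - c)
  have hG : ∀ t q, dist (pt t) q ^ 2 - dist (pt t) p₀ ^ 2 = a q - t * b q := fun t q => by
    simp only [pt, dist_sq_sub_dist_sq_add_smul_sub, b, k, a]
    ring
  have ha : ∀ q ∈ P, 0 ≤ a q := fun q hq =>
    sub_nonneg.2 (pow_le_pow_left₀ dist_nonneg (hτ p₀ hp₀ q hq) 2)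
  have haτ : ∀ p ∈ τ, a p = 0 := fun p hp => by
    have : dist x p = dist x p₀ := le_antisymm (hτ p hp p₀ hp₀P) (hτ p₀ hp₀ p (hτP hp))
    simp [a, this]
  have hbτ : ∀ p ∈ τ, b p = 0 := fun p hp => by
    have : dist c p = dist c p₀ := le_antisymm (hc p hp p₀ hp₀P) (hc p₀ hp₀ p (hτP hp))
    simp [b, haτ p hp, k, this]
  have haσ : ∀ p ∈ σ, a p < δ ^ 2 := fun p hp => by
    have := hx p hp p₀ hp₀P
    simp only [a]; linarith
  have hbσ : ∀ p ∈ σ, p ∉ τ → 0 < b p := fun p hp hpτ => by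
    have h1 := hcδ p₀ hp₀ p (hσP hp) hpτ
    have h2 := haσ p hp
    simp only [b, k]; linarith
  have hδ : 0 < δ ^ 2 := (ha p₁ (hσP hp₁)).trans_lt (haσ p₁ hp₁)
  set t₁ := a p₁ / b p₁ with ht₁
  have ht₁0 : 0 ≤ t₁ := div_nonneg (ha _ (hσP hp₁)) (hbσ _ hp₁ hp₁τ).le
  -- Sites that overtake `p₀` by time `t₁`, when `p₁` would draw level. They lie in a bounded
  -- region, so they are finitely many and some site draws level first.
  let S : Set V := {q | q ∈ P ∧ ∃ t, 0 ≤ t ∧ t ≤ t₁ ∧ a q - t * b q < 0}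
  have hS : S.Finite := by
    refine finite_of_pairwise_le_dist_of_subset_closedBall hμ hP (fun q hq => hq.1) (x := x)
      (r := dist x p₀ + 2 * (t₁ * ‖x - c‖)) ?_
    rintro q ⟨hq, t, ht0, ht, hneg⟩
    rw [← hG, sub_neg] at hneg
    have h1 := lt_of_pow_lt_pow_left₀ 2 dist_nonneg hneg
    have h2 : dist (pt t) x ≤ t₁ * ‖x - c‖ := by
      simp only [pt, dist_self_add_left, norm_smul, Real.norm_of_nonneg ht0]
      gcongr
    have h3 := dist_triangle q (pt t) x
    have h4 := dist_triangle (pt t) x p₀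
    rw [dist_comm q (pt t)] at h3
    rw [Metric.mem_closedBall]
    linarith
  obtain ⟨q, hqS, hmin⟩ := Set.exists_min_image (insert p₁ S) (fun q => a q / b q)
    (hS.insert p₁) ⟨p₁, Set.mem_insert _ _⟩
  have hSb : ∀ q ∈ insert p₁ S, q ∈ P ∧ 0 < b q := by
    rintro q (rfl | ⟨hq, t, ht0, -, hneg⟩)
    · exact ⟨hσP hp₁, hbσ _ hp₁ hp₁τ⟩
    · refine ⟨hq, ?_⟩
      by_contra! hb
      have := ha q hq
      nlinarith [mul_nonneg ht0 (neg_nonneg.2 hb)]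
  obtain ⟨hqP, hqb⟩ := hSb q hqS
  set T := a q / b q with hT
  have hT0 : 0 ≤ T := div_nonneg (ha q hqP) hqb.le
  have hTt : T ≤ t₁ := hmin p₁ (Set.mem_insert _ _)
  have hpos : ∀ q' ∈ P, 0 ≤ a q' - T * b q' := by
    intro q' hq'
    by_cases h : q' ∈ S
    · have h1 := hmin q' (Set.mem_insert_of_mem _ h)
      have h2 := (hSb q' (Set.mem_insert_of_mem _ h)).2
      rw [le_div_iff₀ h2] at h1
      linarith
    · by_contra! hneg
      exact h ⟨hq', T, hT0, hTt, hneg⟩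
  have hnear : ∀ p, a p - T * b p = 0 → ∀ q' ∈ P, dist (pt T) p ≤ dist (pt T) q' := by
    intro p hp q' hq'
    have h1 := hpos q' hq'
    rw [← hG] at hp h1
    exact le_of_sq_le_sq (by linarith) dist_nonneg
  refine ⟨pt T, q, hqP, fun hqτ => ?_, hnear q ?_, fun p hp => hnear p ?_, ?_⟩
  · exact hqb.ne' (hbτ q hqτ)
  · rw [hT, div_mul_cancel₀ _ hqb.ne', sub_self]
  · rw [haτ p hp, hbτ p hp, mul_zero, sub_zero]
  · intro p hp q' hq'
    have h1 : a p - T * b p < δ ^ 2 := by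
      by_cases hpτ : p ∈ τ
      · rwa [haτ p hpτ, hbτ p hpτ, mul_zero, sub_zero]
      · nlinarith [haσ p hp, mul_nonneg hT0 (hbσ p hp hpτ).le]
    have h2 := hpos q' hq'
    rw [← hG] at h1 h2
    linarith

/-- Both `y` and `c` are equidistant from `τ`, so `y - c` is orthogonal to its span; it is not
orthogonal to `q - p₀`, since only `y` is equidistant from these two. -/
theorem vectorSpan_lt_vectorSpan_of_dist_eq {τ τ' : Set V} (hττ' : τ ⊆ τ') {y c p₀ q : V}
    (hp₀ : p₀ ∈ τ) (hq : q ∈ τ') (hy : ∀ p ∈ τ', dist y p = dist y p₀)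
    (hc : ∀ p ∈ τ, dist c p = dist c p₀) (hcq : dist c p₀ ^ 2 < dist c q ^ 2) :
    vectorSpan ℝ τ < vectorSpan ℝ τ' := by
  refine lt_of_le_not_ge (vectorSpan_mono ℝ hττ') fun hle => ?_
  have hinner : ∀ p r : V, 2 * inner ℝ (y - c) (r - p)
      = (dist c r ^ 2 - dist c p ^ 2) - (dist y r ^ 2 - dist y p ^ 2) := fun p r => by
    rw [dist_sq_sub_dist_sq, dist_sq_sub_dist_sq, inner_sub_left]; ring
  have horth : vectorSpan ℝ τ ≤ (ℝ ∙ (y - c))ᗮ := by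
    rw [vectorSpan_def, Submodule.span_le]
    rintro _ ⟨r, hr, p, hp, rfl⟩
    rw [SetLike.mem_coe, Submodule.mem_orthogonal_singleton_iff_inner_right]
    have := hinner p r
    rw [hc r hr, hc p hp, hy r (hττ' hr), hy p (hττ' hp)] at this
    change inner ℝ (y - c) (r - p) = 0
    linarith
  have hmem := horth (hle (vsub_mem_vectorSpan ℝ hq (hττ' hp₀)))
  rw [Submodule.mem_orthogonal_singleton_iff_inner_right, vsub_eq_sub] at hmem
  have := hinner p₀ q
  rw [hmem, hy q hq] at this
  linarith

/-- If every set of sites that is the set of nearest sites of some point has a protected centre,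
then a set of sites whose power gaps at some point are all below the protection has a point at
which all its members are nearest. -/
theorem exists_forall_dist_le_of_dist_sq_lt [FiniteDimensional ℝ V] {P : Set V} {μ δ : ℝ}
    (hμ : 0 < μ) (hP : P.Pairwise fun p q => μ ≤ dist p q)
    (hprot : ∀ τ ⊆ P, τ.Finite → τ.Nonempty → (∃ x, ∀ p ∈ τ, ∀ q ∈ P, dist x p ≤ dist x q) →
      ∃ c, (∀ p ∈ τ, ∀ q ∈ P, dist c p ≤ dist c q) ∧
        ∀ p ∈ τ, ∀ q ∈ P, q ∉ τ → dist c p ^ 2 + δ ^ 2 < dist c q ^ 2)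
    {σ : Set V} (hσ : σ ⊆ P) {x : V}
    (hx : ∀ p ∈ σ, ∀ q ∈ P, dist x p ^ 2 < dist x q ^ 2 + δ ^ 2) :
    ∃ z, ∀ p ∈ σ, ∀ q ∈ P, dist z p ≤ dist z q := by
  rcases σ.eq_empty_or_nonempty with rfl | ⟨s₀, hs₀⟩
  · exact ⟨x, by simp⟩
  -- `m` bounds the missing dimension of the span of the nearest sites. The start value makes the
  -- bound trivial, and `m = 0` is impossible.
  suffices H : ∀ (m : ℕ) (x : V), (∀ p ∈ σ, ∀ q ∈ P, dist x p ^ 2 < dist x q ^ 2 + δ ^ 2) →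
      Module.finrank ℝ V
        < Module.finrank ℝ (vectorSpan ℝ {p ∈ P | ∀ q ∈ P, dist x p ≤ dist x q}) + m →
      ∃ z, ∀ p ∈ σ, ∀ q ∈ P, dist z p ≤ dist z q from
    H (Module.finrank ℝ V + 1) x hx (by omega)
  intro m
  induction m with
  | zero =>
    intro x _ h
    exact absurd (Submodule.finrank_le _) (not_le.2 h)
  | succ m ih =>
    intro x hx h
    set τ : Set V := {p ∈ P | ∀ q ∈ P, dist x p ≤ dist x q} with hτ
    by_cases hsub : σ ⊆ τ
    · exact ⟨x, fun p hp => (hsub hp).2⟩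
    obtain ⟨p₁, hp₁, hp₁τ⟩ := Set.not_subset.1 hsub
    obtain ⟨p₀, hp₀P, hp₀⟩ := exists_forall_dist_le_of_pairwise_le_dist hμ hP ⟨s₀, hσ hs₀⟩ x
    have hp₀τ : p₀ ∈ τ := ⟨hp₀P, hp₀⟩
    have hτP : τ ⊆ P := fun p hp => hp.1
    have hτfin : τ.Finite := finite_of_pairwise_le_dist_of_subset_closedBall hμ hP hτP
      (x := x) (r := dist x p₀) fun p hp => by
        rw [Metric.mem_closedBall, dist_comm]; exact hp.2 p₀ hp₀P
    obtain ⟨c, hc, hcδ⟩ := hprot τ hτP hτfin ⟨p₀, hp₀τ⟩ ⟨x, fun p hp => hp.2⟩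
    obtain ⟨y, q, hqP, hqτ, hyq, hyτ, hyσ⟩ := exists_point_with_additional_nearest hμ hP hσ hτP
      (fun p hp => hp.2) hc hcδ hx hp₀τ hp₁ hp₁τ
    refine ih y hyσ ?_
    set τ' : Set V := {p ∈ P | ∀ q ∈ P, dist y p ≤ dist y q} with hτ'
    have hττ' : τ ⊆ τ' := fun p hp => ⟨hp.1, hyτ p hp⟩
    have hlt : vectorSpan ℝ τ < vectorSpan ℝ τ' := by
      refine vectorSpan_lt_vectorSpan_of_dist_eq (y := y) (c := c) (p₀ := p₀) (q := q) hττ' hp₀τ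
        ⟨hqP, hyq⟩ ?_ ?_ ?_
      · exact fun p hp => le_antisymm (hp.2 p₀ hp₀P) (hyτ p₀ hp₀τ p hp.1)
      · exact fun p hp => le_antisymm (hc p hp p₀ hp₀P) (hc p₀ hp₀τ p hp.1)
      · have := hcδ p₀ hp₀τ q hqP hqτ
        nlinarith [sq_nonneg δ]
    have := Submodule.finrank_lt_finrank_of_lt hlt
    omega

end PowerDifference

/-! ### Comparison of the two complexes -/

section Delaunay

variable {n : ℕ} {Ω P : Set (EuclideanSpace ℝ (Fin n))} {ε μ δ e : ℝ}
  {C : Geometry.SimplicialComplex ℝ (EuclideanSpace ℝ (Fin n))}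
  {col : EuclideanSpace ℝ (Fin n) → EuclideanSpace ℝ (Fin n)}

theorem mem_delaunayComplex_iff {σ : Finset (EuclideanSpace ℝ (Fin n))} :
    σ ∈ delaunayComplex Ω P ↔ σ.Nonempty ∧ (∀ p ∈ σ, p ∈ P) ∧
      ∃ x ∈ Ω, ∀ p ∈ σ, ∀ q ∈ P, dist x p ≤ dist x q := by
  constructor
  · rintro ⟨h1, h2, x, hx⟩
    obtain ⟨p, hp⟩ := h1
    rw [Set.mem_iInter₂] at hx
    exact ⟨⟨p, hp⟩, h2, x, (hx p hp).1, fun q hq => (hx q hq).2⟩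
  · rintro ⟨h1, h2, x, hx, h⟩
    exact ⟨h1, h2, x, Set.mem_iInter₂.2 fun p hp => ⟨hx, h p hp⟩⟩

theorem IsPowerProtected.exists_center (hprot : IsPowerProtected Ω P δ)
    {σ : Finset (EuclideanSpace ℝ (Fin n))} (hσ : σ ∈ delaunayComplex Ω P) :
    ∃ c ∈ Ω, (∀ p ∈ σ, ∀ q ∈ P, dist c p ≤ dist c q) ∧
      ∀ p ∈ σ, ∀ q ∈ P, q ∉ σ → dist c p ^ 2 + δ ^ 2 < dist c q ^ 2 := by
  obtain ⟨c, r, hball, hr⟩ := hprot σ hσ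
  refine ⟨c, hball.center_mem, fun p hp q hq => ?_, fun p hp q hq hqσ => ?_⟩
  · rw [hball.circumscribes p hp]
    exact hball.empty q hq
  · have h := hr q hq hqσ
    rw [Metric.mem_closedBall, not_le, dist_comm, Real.sqrt_lt' ?_] at h
    · rwa [hball.circumscribes p hp]
    · by_contra! hle
      rw [le_antisymm hle dist_nonneg] at h
      exact absurd h (not_lt.2 (Real.sqrt_nonneg _))

/-- A strict bound in `ℝ≥0∞` forces the minimum to be positive, hence also `μ` and `ε`; for `ε ≤ 0`
the quotient would be nonpositive, including division by zero. -/
theorem exists_edge_bound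
    (hedge : maxEdgeLength C < ENNReal.ofReal (min (μ / 16) (δ ^ 2 / (64 * ε)))) :
    0 < μ ∧ 0 < ε ∧ ∃ e : ℝ, 0 ≤ e ∧ e < μ / 16 ∧ 64 * ε * e < δ ^ 2 ∧
      ∀ s ∈ C.faces, ∀ u ∈ s, ∀ v ∈ s, dist u v ≤ e := by
  have hpos := ENNReal.ofReal_pos.1 (bot_le.trans_lt hedge)
  obtain ⟨h1, h2⟩ := lt_min_iff.1 hpos
  have hε : 0 < ε := by
    by_contra! hle
    exact absurd h2 (not_lt.2 (div_nonpos_of_nonneg_of_nonpos (sq_nonneg δ) (by linarith)))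
  have hfin : maxEdgeLength C ≠ ∞ := (hedge.trans_le le_top).ne
  have hlt := (ENNReal.lt_ofReal_iff_toReal_lt hfin).1 hedge
  obtain ⟨h3, h4⟩ := lt_min_iff.1 hlt
  refine ⟨by linarith, hε, (maxEdgeLength C).toReal, ENNReal.toReal_nonneg, h3, ?_, ?_⟩
  · rw [lt_div_iff₀ (by positivity)] at h4
    linarith
  · intro s hs u hu v hv
    rw [dist_edist]
    refine ENNReal.toReal_mono hfin ?_
    exact le_iSup₂_of_le s hs (le_iSup₂_of_le u hu (le_iSup₂_of_le v hv le_rfl))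

theorem dist_lt_dist_add_of_mem_discreteVoronoiCell (hcol : IsNearestSiteColouring C P col)
    (he : ∀ s ∈ C.faces, ∀ u ∈ s, ∀ v ∈ s, dist u v ≤ e) {x p : EuclideanSpace ℝ (Fin n)}
    (hx : x ∈ discreteVoronoiCell C col p) {q : EuclideanSpace ℝ (Fin n)} (hq : q ∈ P) :
    p ∈ P ∧ dist x p ≤ dist x q + 2 * e := by
  obtain ⟨s, hs, ⟨v, hv, rfl⟩, hxs⟩ := hx
  have hvC : v ∈ C.vertices := C.down_closed hs (Finset.singleton_subset_iff.2 hv)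
    (Finset.singleton_nonempty v)
  have hxv : dist x v ≤ e := convexHull_min
    (fun u hu => Metric.mem_closedBall.2 (he s hs u hu v hv)) (convex_closedBall v e) hxs
  refine ⟨(hcol v hvC).1, ?_⟩
  have h1 := (hcol v hvC).2 q hq
  have h2 := dist_triangle x v (col v)
  have h3 := dist_triangle_left v q x
  linarith

/-- A point of the discrete cell of `p` is almost nearest to `p`, up to a power gap smaller than the
protection. -/
theorem dist_sq_lt_of_mem_discreteVoronoiCell (hnet : IsNet Ω P ε μ)
    (hcol : IsNearestSiteColouring C P col) (hε : 0 < ε) (he0 : 0 ≤ e) (heμ : e < μ / 16)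
    (heδ : 64 * ε * e < δ ^ 2) (he : ∀ s ∈ C.faces, ∀ u ∈ s, ∀ v ∈ s, dist u v ≤ e)
    {x p q : EuclideanSpace ℝ (Fin n)} (hxΩ : x ∈ closure Ω)
    (hx : x ∈ discreteVoronoiCell C col p) (hq : q ∈ P) :
    dist x p ^ 2 < dist x q ^ 2 + δ ^ 2 := by
  obtain ⟨hp, hpq⟩ := dist_lt_dist_add_of_mem_discreteVoronoiCell hcol he hx hq
  have hδ : 0 < δ ^ 2 := lt_of_le_of_lt (by positivity) heδ
  rcases le_or_gt (dist x p) (dist x q) with hle | hlt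
  · have := pow_le_pow_left₀ dist_nonneg hle 2
    linarith
  have hne : p ≠ q := by rintro rfl; exact lt_irrefl _ hlt
  -- `x` may lie on the frontier, where the sampling condition holds only in the limit.
  have hxε : dist x p ≤ ε + 2 * e := by
    refine le_of_forall_pos_le_add fun γ hγ => ?_
    obtain ⟨y, hy, hxy⟩ := Metric.mem_closure_iff.1 hxΩ γ hγ
    obtain ⟨q', hq', hyq'⟩ := hnet.sample y hy
    have h1 := (dist_lt_dist_add_of_mem_discreteVoronoiCell hcol he hx hq').2
    have h2 := dist_triangle x y q'
    linarith
  have hμ := hnet.separated p hp q hq hne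
  have h3 := dist_triangle_left p q x
  -- From `16 * e < μ ≤ dist p q ≤ 2 * dist x p ≤ 2 * ε + 4 * e`.
  have heε : 6 * e ≤ ε := by linarith
  have hd0 : 0 ≤ dist x q := dist_nonneg
  have hgap : (dist x p - dist x q) * (dist x p + dist x q) ≤ (2 * e) * (2 * (ε + 2 * e)) := by
    refine mul_le_mul (by linarith) (by linarith) (by positivity) (by positivity)
  nlinarith [mul_le_mul_of_nonneg_left heε he0, mul_nonneg hε.le he0]

theorem IsNet.pairwise (hnet : IsNet Ω P ε μ) : P.Pairwise fun p q => μ ≤ dist p q :=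
  fun p hp q hq hpq => hnet.separated p hp q hq hpq

theorem discreteDelaunayComplex_subset (hnet : IsNet Ω P ε μ) (hprot : IsPowerProtected Ω P δ)
    (hboundary : delaunayComplex Ω P = delaunayComplex Set.univ P) (hC : IsCanvas Ω C)
    (hcol : IsNearestSiteColouring C P col) (hμ : 0 < μ) (hε : 0 < ε) (he0 : 0 ≤ e)
    (heμ : e < μ / 16) (heδ : 64 * ε * e < δ ^ 2)
    (he : ∀ s ∈ C.faces, ∀ u ∈ s, ∀ v ∈ s, dist u v ≤ e) :
    discreteDelaunayComplex C P col ⊆ delaunayComplex Ω P := by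
  rintro σ ⟨hne, hσP, x, hx⟩
  rw [Set.mem_iInter₂] at hx
  obtain ⟨p₀, hp₀⟩ := hne
  have hxΩ : x ∈ closure Ω := by
    obtain ⟨s, hs, -, hxs⟩ := hx p₀ hp₀
    exact hC.space_subset (Geometry.SimplicialComplex.mem_space_iff.2 ⟨s, hs, hxs⟩)
  have hcentre : ∀ τ ⊆ P, τ.Finite → τ.Nonempty →
      (∃ x, ∀ p ∈ τ, ∀ q ∈ P, dist x p ≤ dist x q) →
      ∃ c, (∀ p ∈ τ, ∀ q ∈ P, dist c p ≤ dist c q) ∧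
        ∀ p ∈ τ, ∀ q ∈ P, q ∉ τ → dist c p ^ 2 + δ ^ 2 < dist c q ^ 2 := by
    rintro τ hτP hτfin hτne ⟨y, hy⟩
    lift τ to Finset (EuclideanSpace ℝ (Fin n)) using hτfin
    have hτ : τ ∈ delaunayComplex Ω P := by
      rw [hboundary, mem_delaunayComplex_iff]
      exact ⟨by simpa using hτne, fun p hp => hτP hp, y, Set.mem_univ y, hy⟩
    obtain ⟨c, -, hc⟩ := hprot.exists_center hτ
    exact ⟨c, hc⟩
  obtain ⟨z, hz⟩ := exists_forall_dist_le_of_dist_sq_lt (δ := δ) (σ := (σ : Set _)) (x := x) hμ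
    hnet.pairwise hcentre (fun p hp => hσP p hp) fun p hp q hq =>
      dist_sq_lt_of_mem_discreteVoronoiCell hnet hcol hε he0 heμ heδ he hxΩ (hx p hp) hq
  rw [hboundary, mem_delaunayComplex_iff]
  exact ⟨⟨p₀, hp₀⟩, hσP, z, Set.mem_univ z, hz⟩

/-- Near a point of `Ω` the cell is a finite union of compact simplices, hence closed relative to
`Ω`. -/
theorem mem_discreteVoronoiCell_of_mem_closure (hC : IsCanvas Ω C)
    {x p : EuclideanSpace ℝ (Fin n)} (hx : x ∈ Ω)
    (hcl : x ∈ closure (discreteVoronoiCell C col p)) : x ∈ discreteVoronoiCell C col p := by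
  obtain ⟨U, hU, hfin⟩ := hC.locallyFinite x hx
  let F := {s | s ∈ C.faces ∧
      (convexHull ℝ (s : Set (EuclideanSpace ℝ (Fin n))) ∩ U).Nonempty}
  let Z : Set (EuclideanSpace ℝ (Fin n)) :=
    ⋃ s ∈ {s ∈ F | ∃ v ∈ s, col v = p}, convexHull ℝ (s : Set (EuclideanSpace ℝ (Fin n)))
  have hZ : IsClosed Z := (hfin.subset (Set.sep_subset _ _)).isClosed_biUnion fun s _ =>
    (s.finite_toSet.isCompact_convexHull ℝ).isClosed
  have hxZ : x ∈ closure Z := by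
    rw [mem_closure_iff_nhds] at hcl ⊢
    intro t ht
    obtain ⟨y, ⟨hyt, hyU⟩, s, hs, hv, hys⟩ := hcl (t ∩ U) (Filter.inter_mem ht hU)
    exact ⟨y, hyt, Set.mem_biUnion (show s ∈ {s ∈ F | ∃ v ∈ s, col v = p} from
      ⟨⟨hs, y, hys, hyU⟩, hv⟩) hys⟩
  rw [hZ.closure_eq] at hxZ
  obtain ⟨s, ⟨⟨hs, -⟩, hv⟩, hxs⟩ := Set.mem_iUnion₂.1 hxZ
  exact ⟨s, hs, hv, hxs⟩

theorem exists_mem_discreteVoronoiCell (hC : IsCanvas Ω C) (hcol : IsNearestSiteColouring C P col)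
    {x : EuclideanSpace ℝ (Fin n)} (hx : x ∈ Ω) : ∃ p ∈ P, x ∈ discreteVoronoiCell C col p := by
  obtain ⟨s, hs, hxs⟩ := Geometry.SimplicialComplex.mem_space_iff.1 (hC.covers hx)
  obtain ⟨v, hv⟩ := C.nonempty_of_mem_faces hs
  have hvC : v ∈ C.vertices := C.down_closed hs (Finset.singleton_subset_iff.2 hv)
    (Finset.singleton_nonempty v)
  exact ⟨col v, (hcol v hvC).1, s, hs, ⟨v, hv, rfl⟩, hxs⟩

/-! ### Multilinear weights on the cube -/

section CubeWeight

variable {ι : Type*} [Fintype ι] [DecidableEq ι]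

/-- The multilinear weight at `a` of the vertex of the unit cube that vanishes exactly on `τ`. -/
def cubeWeight (a : ι → ℝ) (τ : Finset ι) : ℝ :=
  (∏ i ∈ τ, (1 - a i)) * ∏ i ∈ Finset.univ \ τ, a i

/-- Expand the product of the factors `(1 - a i) + a i = 1`. -/
theorem sum_cubeWeight (a : ι → ℝ) : ∑ τ : Finset ι, cubeWeight a τ = 1 := by
  have h := Finset.prod_add (fun i => 1 - a i) a Finset.univ
  simp only [sub_add_cancel, Finset.prod_const_one, Finset.powerset_univ] at h
  exact h.symm

theorem cubeWeight_nonneg {a : ι → ℝ} (ha : ∀ i, 0 ≤ a i ∧ a i ≤ 1) (τ : Finset ι) :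
    0 ≤ cubeWeight a τ :=
  mul_nonneg (Finset.prod_nonneg fun i _ => sub_nonneg.2 (ha i).2)
    (Finset.prod_nonneg fun i _ => (ha i).1)

theorem mem_of_cubeWeight_ne_zero {a : ι → ℝ} {τ : Finset ι} (h : cubeWeight a τ ≠ 0) {i : ι}
    (hi : a i = 0) : i ∈ τ := by
  by_contra hiτ
  exact h (mul_eq_zero_of_right _ (Finset.prod_eq_zero (by simpa using hiτ) hi))

theorem notMem_of_cubeWeight_ne_zero {a : ι → ℝ} {τ : Finset ι} (h : cubeWeight a τ ≠ 0) {i : ι}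
    (hi : a i = 1) : i ∉ τ := fun hiτ =>
  h (mul_eq_zero_of_left (Finset.prod_eq_zero hiτ (by rw [hi, sub_self])) _)

theorem continuous_cubeWeight (τ : Finset ι) : Continuous fun a : ι → ℝ => cubeWeight a τ := by
  unfold cubeWeight
  fun_prop

end CubeWeight

theorem Convex.sum_mem_of_ne_zero {V ι : Type*} [AddCommGroup V] [Module ℝ V] {S : Set V}
    (hS : Convex ℝ S) {t : Finset ι} {w : ι → ℝ} {z : ι → V} (hw0 : ∀ i ∈ t, 0 ≤ w i)
    (hw : ∑ i ∈ t, w i = 1) (hz : ∀ i ∈ t, w i ≠ 0 → z i ∈ S) : ∑ i ∈ t, w i • z i ∈ S := by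
  rw [← Finset.sum_filter_of_ne (p := fun i => w i ≠ 0)
    fun i _ h h0 => h (by rw [h0, zero_smul])]
  refine hS.sum_mem (fun i hi => hw0 i (Finset.mem_filter.1 hi).1) ?_
    fun i hi => hz i (Finset.mem_filter.1 hi).1 (Finset.mem_filter.1 hi).2
  rw [Finset.sum_filter_of_ne fun i _ h => h, hw]

theorem delaunayComplex_subset (hnet : IsNet Ω P ε μ) (hprot : IsPowerProtected Ω P δ)
    (hconvex : ∀ p ∈ P, Convex ℝ (voronoiCell Ω P p)) (hC : IsCanvas Ω C)
    (hcol : IsNearestSiteColouring C P col) (hε : 0 < ε) (he0 : 0 ≤ e)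
    (heμ : e < μ / 16) (heδ : 64 * ε * e < δ ^ 2)
    (he : ∀ s ∈ C.faces, ∀ u ∈ s, ∀ v ∈ s, dist u v ≤ e) :
    delaunayComplex Ω P ⊆ discreteDelaunayComplex C P col := by
  classical
  intro σ hσ
  obtain ⟨hσne, hσP, x₀, hx₀, hσx⟩ := mem_delaunayComplex_iff.1 hσ
  -- The empty face gets an arbitrary centre: its weight is the product of all `a i`, which vanishes
  -- on the lower faces.
  have hcen : ∀ τ : Finset σ, ∃ c, τ.Nonempty → c ∈ Ω ∧
      (∀ p ∈ τ, ∀ q ∈ P, dist c p ≤ dist c q) ∧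
      ∀ p ∈ τ, ∀ q ∈ P, q ∉ τ.map (Function.Embedding.subtype _) →
        dist c p ^ 2 + δ ^ 2 < dist c q ^ 2 := by
    intro τ
    by_cases hτ : τ.Nonempty
    · have hτσ : τ.map (Function.Embedding.subtype _) ∈ delaunayComplex Ω P := by
        refine mem_delaunayComplex_iff.2 ⟨hτ.map, fun p hp => ?_, x₀, hx₀, fun p hp => ?_⟩
        · obtain ⟨p, -, rfl⟩ := Finset.mem_map.1 hp
          exact hσP p p.2
        · obtain ⟨p, -, rfl⟩ := Finset.mem_map.1 hp
          exact hσx p p.2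
      obtain ⟨c, hcΩ, hc, hcδ⟩ := hprot.exists_center hτσ
      exact ⟨c, fun _ => ⟨hcΩ, fun p hp => hc p (Finset.mem_map_of_mem _ hp),
        fun p hp => hcδ p (Finset.mem_map_of_mem _ hp)⟩⟩
    · exact ⟨0, fun h => absurd h hτ⟩
  choose c hc using hcen
  let x : (σ → ℝ) → EuclideanSpace ℝ (Fin n) := fun a => ∑ τ : Finset σ, cubeWeight a τ • c τ
  have hxcont : Continuous x := continuous_finsetSum _ fun τ _ =>
    (continuous_cubeWeight τ).smul continuous_const
  let K : Set (σ → ℝ) := {a | (∀ i, 0 ≤ a i ∧ a i ≤ 1) ∧ ∃ i, a i = 0}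
  have hK : IsClosed K := by
    have : K = (⋂ i, {a | 0 ≤ a i ∧ a i ≤ 1}) ∩ ⋃ i, {a | a i = 0} := by
      ext a; simp [K]
    rw [this]
    refine (isClosed_iInter fun i => ?_).inter (isClosed_iUnion_of_finite fun i => ?_)
    · exact (isClosed_le continuous_const (continuous_apply i)).inter
        (isClosed_le (continuous_apply i) continuous_const)
    · exact isClosed_eq (continuous_apply i) continuous_const
  have hxΩ : ∀ a ∈ K, x a ∈ Ω := by
    rintro a ⟨ha, i, hi⟩
    refine ((hconvex i (hσP i i.2)).sum_mem_of_ne_zero (fun τ _ => cubeWeight_nonneg ha τ)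
      (sum_cubeWeight a) fun τ _ hτ => ?_ : x a ∈ voronoiCell Ω P i).1
    have hiτ := mem_of_cubeWeight_ne_zero hτ hi
    obtain ⟨h1, h2, -⟩ := hc τ ⟨i, hiτ⟩
    exact ⟨h1, h2 i hiτ⟩
  -- Covers both sites outside `σ` and sites of `σ` whose coordinate is 1: no `τ` of nonzero weight
  -- contains `q`, while all of them contain `i`. The gap of `q` over `i` is thus at least `δ ^ 2`
  -- at every contributing centre, and by affinity at `x a`.
  have hexcl : ∀ a ∈ K, ∀ q ∈ P, (∀ i : σ, (i : EuclideanSpace ℝ (Fin n)) = q → a i = 1) →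
      x a ∉ discreteVoronoiCell C col q := by
    rintro a ⟨ha, i, hi⟩ q hq hqa hmem
    have h1 := dist_sq_lt_of_mem_discreteVoronoiCell hnet hcol hε he0 heμ heδ he
      (subset_closure (hxΩ a ⟨ha, i, hi⟩)) hmem (hσP i i.2)
    have h2 : δ ^ 2 ≤ dist (x a) q ^ 2 - dist (x a) i ^ 2 :=
      le_dist_sq_sub_dist_sq_sum _ _ _ (sum_cubeWeight a) (fun τ _ => cubeWeight_nonneg ha τ)
        _ _ _ fun τ _ hτ => by
          have hiτ := mem_of_cubeWeight_ne_zero hτ hi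
          have h3 := (hc τ ⟨i, hiτ⟩).2.2 i hiτ q hq fun hqτ => by
            obtain ⟨j, hj, hjq⟩ := Finset.mem_map.1 hqτ
            exact notMem_of_cubeWeight_ne_zero hτ (hqa j hjq) hj
          linarith
    linarith
  let B : σ → Set (σ → ℝ) := fun i => {a | a ∈ K ∧ x a ∈ discreteVoronoiCell C col i}
  have : Nonempty σ := hσne.to_subtype
  suffices H : (⋂ i, B i).Nonempty by
    obtain ⟨a, ha⟩ := H
    rw [Set.mem_iInter] at ha
    exact ⟨hσne, hσP, x a, Set.mem_iInter₂.2 fun p hp => (ha ⟨p, hp⟩).2⟩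
  refine nonempty_iInter_of_cover_lower_faces B ?_ ?_ ?_
  · intro i
    refine isClosed_of_closure_subset fun a ha => ?_
    have haK : a ∈ K := hK.closure_subset_iff.2 (fun b hb => hb.1) ha
    exact ⟨haK, mem_discreteVoronoiCell_of_mem_closure hC (hxΩ a haK)
      (map_mem_closure hxcont ha fun b hb => hb.2)⟩
  · intro a ha h0
    obtain ⟨q, hq, hxq⟩ := exists_mem_discreteVoronoiCell hC hcol (hxΩ a ⟨ha, h0⟩)
    by_cases hqσ : q ∈ σ
    · exact ⟨⟨q, hqσ⟩, ⟨ha, h0⟩, hxq⟩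
    · exact absurd hxq (hexcl a ⟨ha, h0⟩ q hq fun i hi => absurd (hi ▸ i.2) hqσ)
  · intro i a ha hai
    refine hexcl a ha.1 i (hσP i i.2) (fun j hj => ?_) ha.2
    rwa [Subtype.coe_injective hj]

end Delaunay

theorem mainTheorem2 {n : ℕ} (Ω P : Set (EuclideanSpace ℝ (Fin n))) (ε μ δ : ℝ)
    (hΩ : IsOpen Ω)
    (hnet : IsNet Ω P ε μ)
    (hprot : IsPowerProtected Ω P δ)
    (hconvex : ∀ p ∈ P, Convex ℝ (voronoiCell Ω P p))
    (hboundary : delaunayComplex Ω P = delaunayComplex Set.univ P)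
    (C : Geometry.SimplicialComplex ℝ (EuclideanSpace ℝ (Fin n)))
    (hC : IsCanvas Ω C)
    (col : EuclideanSpace ℝ (Fin n) → EuclideanSpace ℝ (Fin n))
    (hcol : IsNearestSiteColouring C P col)
    (hedge : maxEdgeLength C < ENNReal.ofReal (min (μ / 16) (δ ^ 2 / (64 * ε)))) :
    discreteDelaunayComplex C P col = delaunayComplex Ω P := by
  obtain ⟨hμ, hε, e, he0, heμ, heδ, he⟩ := exists_edge_bound hedge
  exact Set.Subset.antisymm
    (discreteDelaunayComplex_subset hnet hprot hboundary hC hcol hμ hε he0 heμ heδ he)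
    (delaunayComplex_subset hnet hprot hconvex hC hcol hε he0 heμ heδ he)
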